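/- Let $k$ be a field, $\bar k$ an algebraic closure of $k$, $n\in\mathbb N$, $A=k[x_1,\dots,x_n]$ the polynomial ring in $n$ indeterminates, and $\mathfrak p$ a prime ideal of $A$ with residue field $k(\mathfrak p)=A_{\mathfrak p}/\mathfrak pA_{\mathfrak p}$. Let $\operatorname{Specm}_{\mathrm{sep}}(A)$ be the set of maximal ideals $\mathfrak m$ of $A$ such that $k(\mathfrak m)/k$ is a separable algebraic extension, and let $V(\mathfrak p)\subseteq\operatorname{Spec}(A)$ be the set of prime ideals containing $\mathfrak p$, with the Zariski topology. The following statements are equivalent: 1. $k(\mathfrak p)$ is formally smooth over $k$. 2. There exist $r\in\mathbb N$ (possibly $r=0$, the empty determinant being $1$), $k$-derivations $d_1,\dots,d_r\in\operatorname{Der}_k(A,A)$ and elements $g_1,\dots,g_r\in A$ such that $\mathfrak pA_{\mathfrak p}=\langle \frac{g_1}{1},\dots,\frac{g_r}{1}\rangle$ and $\det\big((d_i(g_j))_{1\le i,j\le r}\big)\notin\mathfrak p$. 3. $k(\mathfrak p)$ is separably generated over $k$, i.e. there is a transcendence basis $T$ of $k(\mathfrak p)/k$ such that $k(\mathfrak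 p)$ is a separable algebraic extension of $k(T)$. 4. $k(\mathfrak p)\otimes_k\bar k$ is reduced. 5. $\operatorname{Specm}_{\mathrm{sep}}(A)\cap V(\mathfrak p)$ is dense in $V(\mathfrak p)$. 6. $\mathfrak p=\bigcap_{\mathfrak m\in\operatorname{Specm}_{\mathrm{sep}}(A)\cap V(\mathfrak p)}\mathfrak m$, where an empty intersection is $A$. -/

import Mathlib

open scoped TensorProduct

/-- A field extension `K / k` is separably generated if `K` has a transcendence basis `T` over `k`
such that `K` is a separable algebraic extension of `k(T)`. -/
def SeparablyGenerated (k K : Type*) [Field k] [Field K] [Algebra k K] : Prop :=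
  ∃ T : Set K, IsTranscendenceBasis k ((↑) : T → K) ∧
    Algebra.IsSeparable (IntermediateField.adjoin k T) K

/-- The maximal separable spectrum of a `k`-algebra `B`: the maximal ideals of `B` whose residue
field is a separable algebraic extension of `k`, viewed as a subset of `Spec B`. -/
def specmSep (k B : Type*) [Field k] [CommRing B] [Algebra k B] : Set (PrimeSpectrum B) :=
  {m | m.asIdeal.IsMaximal ∧ Algebra.IsSeparable k m.asIdeal.ResidueField}

/-!
Let `κ` be the residue field of a local ring `(R, m)` that is formally smooth over `k`. Then `κ` is
formally smooth over `k` iff `m / m² → κ ⊗ Ω[R⁄k]` is injective, that is, iff every element of `m`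
killed by all derivations `R → κ` lies in `m²`. For `R = A_p` these derivations factor through a
dual basis of the finite projective module `Ω[A⁄k]`. For a minimal system of generators of `p A_p`
the criterion therefore says that its Jacobian matrix over `κ` has linearly independent columns,
that is, a nonvanishing maximal minor.

For `k(p) ⊗ L` reduced and `L` perfect of characteristic `ℓ > 0`, taking `ℓ`-th roots of
coefficients in `L` shows that `ℓ`-th powers preserve linear independence over `k` in `k(p)`, and
MacLane's criterion applies.

If `k(p)` is formally smooth, a nonempty open subset of `Spec (A ⧸ p)` is étale over an affine
space. In the latter the points with coordinates in the infinite field `kˢᵉᵖ` are dense, and étale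
maps are open with separable residue extensions. Conversely, if `p` is the intersection of maximal
ideals `m` with separable residue field, `A ⧸ p` embeds into the product of the `k(m)`. Each
`L ⊗ k(m)` is reduced, and a basis of `L` over `k` shows that these detect the zero element of
`L ⊗ (A ⧸ p)`, whose localization `L ⊗ k(p)` is then reduced too.
-/

section Jacobian

open IsLocalRing KaehlerDifferential

theorem one_tmul_D_eq_zero_iff_forall_derivation {k R K : Type*} [CommRing k] [CommRing R]
    [Field K] [Algebra k R] [Algebra R K] [Algebra k K] [IsScalarTower k R K] (x : R) :
    (1 : K) ⊗ₜ[R] D k R x = 0 ↔ ∀ δ : Derivation k R K, δ x = 0 := by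
  refine ⟨fun hx δ => ?_, fun hx => (Module.forall_dual_apply_eq_zero_iff K _).1 fun φ => ?_⟩
  · simpa using congr(δ.liftKaehlerDifferential.liftBaseChange K $hx)
  · exact hx (((φ.restrictScalars R) ∘ₗ TensorProduct.mk R K Ω[R⁄k] 1).compDer (D k R))

theorem formallySmooth_residueField_iff_forall_derivation {k R : Type*} [CommRing k] [CommRing R]
    [IsLocalRing R] [Algebra k R] [Algebra.FormallySmooth k R] :
    Algebra.FormallySmooth k (ResidueField R) ↔
      ∀ x ∈ maximalIdeal R, (∀ δ : Derivation k R (ResidueField R), δ x = 0) →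
        x ∈ maximalIdeal R ^ 2 := by
  have hker : RingHom.ker (algebraMap R (ResidueField R)) = maximalIdeal R := ker_residue
  simp only [← one_tmul_D_eq_zero_iff_forall_derivation]
  rw [Algebra.formallySmooth_iff, and_iff_right (Module.Projective.of_free),
    ← Algebra.FormallySmooth.kerCotangentToTensor_injective_iff (P := R) residue_surjective,
    injective_iff_map_eq_zero, (Ideal.toCotangent_surjective _).forall]
  simp only [kerCotangentToTensor_toCotangent, Ideal.toCotangent_eq_zero, Subtype.forall, hker]

theorem exists_derivation_extending_of_formallyEtale {k A B M : Type*} [CommRing k] [CommRing A]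
    [CommRing B] [Algebra k A] [Algebra k B] [Algebra A B] [IsScalarTower k A B]
    [Algebra.FormallyEtale A B] [AddCommGroup M] [Module k M] [Module A M] [Module B M]
    [IsScalarTower A B M] [IsScalarTower k A M] [IsScalarTower k B M] (d : Derivation k A M) :
    ∃ δ : Derivation k B M, ∀ a, δ (algebraMap A B a) = d a := by
  refine ⟨((d.liftKaehlerDifferential.liftBaseChange B) ∘ₗ
    (tensorKaehlerEquivOfFormallyEtale k A B).symm.toLinearMap).compDer (D k B), fun a => ?_⟩
  simp [tensorKaehlerEquivOfFormallyEtale_symm_D_algebraMap]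

theorem exists_derivation_D_eq_sum_smul (k A : Type*) [CommRing k] [CommRing A] [Algebra k A]
    [Module.Finite A Ω[A⁄k]] [Module.Projective A Ω[A⁄k]] :
    ∃ (n : ℕ) (d : Fin n → Derivation k A A) (ω : Fin n → Ω[A⁄k]),
      ∀ a, D k A a = ∑ i, d i a • ω i := by
  obtain ⟨n, f, g, -, -, hfg⟩ := Module.Finite.exists_comp_eq_id_of_projective A Ω[A⁄k]
  refine ⟨n, fun i => (LinearMap.proj i ∘ₗ g).compDer (D k A), fun i => f (Pi.single i 1),
    fun a => ?_⟩
  calc D k A a = f (g (D k A a)) := congr($hfg (D k A a)).symm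
    _ = _ := by
      conv_lhs => rw [pi_eq_sum_univ' (g (D k A a))]
      simp

theorem derivation_sum_mul_of_map_eq_zero {k R K ι : Type*} [CommRing k] [CommRing R]
    [CommRing K] [Algebra k R] [Algebra R K] [Module k K] [Fintype ι] (δ : Derivation k R K)
    (a x : ι → R) (hx : ∀ j, algebraMap R K (x j) = 0) :
    δ (∑ j, a j * x j) = ∑ j, algebraMap R K (a j) * δ (x j) := by
  rw [map_sum]
  refine Finset.sum_congr rfl fun j _ => ?_
  rw [Derivation.leibniz, Algebra.smul_def, Algebra.smul_def, hx, zero_mul, add_zero]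

theorem formallySmooth_residueField_of_det_notMem {k A ι : Type*} [CommRing k] [CommRing A]
    [Algebra k A] [Algebra.FormallySmooth k A] [Fintype ι] [DecidableEq ι] (p : Ideal A) [p.IsPrime]
    (d : ι → Derivation k A A) (g : ι → A)
    (hg : p.map (algebraMap A (Localization.AtPrime p)) =
      Ideal.span (Set.range fun i => algebraMap A (Localization.AtPrime p) (g i)))
    (hdet : (Matrix.of fun i j => d i (g j)).det ∉ p) :
    Algebra.FormallySmooth k p.ResidueField := by
  let R := Localization.AtPrime p
  have : Algebra.FormallyEtale A R := .of_isLocalization p.primeCompl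
  have : Algebra.FormallySmooth k R := .comp k A R
  rw [Localization.AtPrime.map_eq_maximalIdeal] at hg
  have hgm (j) : algebraMap A R (g j) ∈ maximalIdeal R := hg ▸ Ideal.subset_span ⟨j, rfl⟩
  refine formallySmooth_residueField_iff_forall_derivation.2 fun x hx hδx => ?_
  obtain ⟨a, rfl⟩ := Ideal.mem_span_range_iff_exists_fun.1 (hg ▸ hx)
  let J : Matrix ι ι p.ResidueField :=
    (algebraMap A p.ResidueField).mapMatrix (Matrix.of fun i j => d i (g j))
  have hJ : J.det ≠ 0 := by rwa [← RingHom.map_det, Ne, Ideal.algebraMap_residueField_eq_zero]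
  have hJa : J.mulVec (fun j => residue R (a j)) = 0 := by
    ext i
    obtain ⟨δ, hδ⟩ := exists_derivation_extending_of_formallyEtale (B := R)
      ((Algebra.linearMap A p.ResidueField).compDer (d i))
    have := hδx δ
    rw [derivation_sum_mul_of_map_eq_zero δ a _ fun j => (residue_eq_zero_iff _).2 (hgm j)]
      at this
    simpa [J, Matrix.mulVec, dotProduct, hδ, mul_comm, R, ResidueField.algebraMap_eq] using this
  have ha (j) : a j ∈ maximalIdeal R :=
    (residue_eq_zero_iff _).1 (congr_fun (Matrix.eq_zero_of_mulVec_eq_zero hJ hJa) j)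
  rw [pow_two]
  exact Ideal.sum_mem _ fun j _ => Ideal.mul_mem_mul (ha j) (hgm j)

theorem exists_det_submatrix_ne_zero {K m n : Type*} [Field K] [Finite m] [Fintype n]
    [DecidableEq n] {M : Matrix m n K} (hM : LinearIndependent K M.col) :
    ∃ f : n → m, (M.submatrix f id).det ≠ 0 := by
  obtain ⟨κ, a, ha, hspan, hli⟩ := exists_linearIndependent' K M.row
  have := Fintype.ofFinite m
  have := Fintype.ofInjective a ha
  have hcard : Fintype.card n = Fintype.card κ := by
    rw [linearIndependent_iff_card_eq_finrank_span.1 hM,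
      linearIndependent_iff_card_eq_finrank_span.1 hli, Set.finrank, Set.finrank, hspan,
      ← Matrix.rank_eq_finrank_span_row, Matrix.rank_eq_finrank_span_cols]
  let e := Fintype.equivOfCardEq hcard
  refine ⟨a ∘ e, IsUnit.ne_zero ((Matrix.isUnit_iff_isUnit_det _).1 ?_)⟩
  exact Matrix.linearIndependent_rows_iff_isUnit.1 (hli.comp e e.injective)

theorem span_toCotangent_eq_top_iff {R ι : Type*} [CommRing R] [IsLocalRing R] [IsNoetherianRing R]
    (v : ι → maximalIdeal R) :
    Submodule.span (ResidueField R) (Set.range fun i => (maximalIdeal R).toCotangent (v i)) = ⊤ ↔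
      Ideal.span (Set.range fun i => (v i : R)) = maximalIdeal R := by
  rw [Set.range_comp' (maximalIdeal R).toCotangent, CotangentSpace.span_image_eq_top_iff,
    ← (Submodule.map_injective_of_injective (maximalIdeal R).injective_subtype).eq_iff,
    Submodule.map_span, Submodule.map_top, Submodule.range_subtype, ← Set.range_comp]
  rfl

theorem exists_minimal_generators_maximalIdeal {R ι : Type*} [CommRing R] [IsLocalRing R]
    [IsNoetherianRing R] (v : ι → R) (hv : Ideal.span (Set.range v) = maximalIdeal R) :
    ∃ (r : ℕ) (e : Fin r → ι), Ideal.span (Set.range fun j => v (e j)) = maximalIdeal R ∧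
      ∀ a : Fin r → R, ∑ j, a j * v (e j) ∈ maximalIdeal R ^ 2 → ∀ j, a j ∈ maximalIdeal R := by
  let w (i : ι) : maximalIdeal R := ⟨v i, hv ▸ Ideal.subset_span ⟨i, rfl⟩⟩
  obtain ⟨κ, s, -, hspan, hli⟩ := exists_linearIndependent' (ResidueField R) fun i =>
    (maximalIdeal R).toCotangent (w i)
  have := hli.finite
  let t := (Finite.equivFin κ).symm
  refine ⟨Nat.card κ, s ∘ t, ?_, fun a ha j => ?_⟩
  · rw [(span_toCotangent_eq_top_iff w).2 hv] at hspan
    rw [← (span_toCotangent_eq_top_iff _).1 hspan, ← t.surjective.range_comp]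
    rfl
  · have hsum : ∑ j, residue R (a j) • (maximalIdeal R).toCotangent (w (s (t j))) = 0 := by
      have : (maximalIdeal R).toCotangent (∑ j, a j • w (s (t j))) = 0 := by
        rw [Ideal.toCotangent_eq_zero]
        simpa [w] using ha
      simp only [map_sum, map_smul] at this
      exact this
    exact (residue_eq_zero_iff _).1
      (Fintype.linearIndependent_iff.1 (hli.comp t t.injective) _ hsum j)

theorem linearIndependent_jacobian_col {k A ι κ : Type*} [CommRing k] [CommRing A] [Algebra k A]
    [Algebra.FormallySmooth k A] [Fintype ι] [Fintype κ] (p : Ideal A) [p.IsPrime]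
    [Algebra.FormallySmooth k p.ResidueField] {g : ι → A} (hg : ∀ j, g j ∈ p)
    (hmin : ∀ a : ι → Localization.AtPrime p,
      ∑ j, a j * algebraMap A _ (g j) ∈ maximalIdeal (Localization.AtPrime p) ^ 2 →
        ∀ j, a j ∈ maximalIdeal (Localization.AtPrime p))
    {d : κ → Derivation k A A} {ω : κ → Ω[A⁄k]} (hd : ∀ a, D k A a = ∑ i, d i a • ω i) :
    LinearIndependent p.ResidueField
      (Matrix.of fun i j => algebraMap A p.ResidueField (d i (g j))).col := by
  let R := Localization.AtPrime p
  have : Algebra.FormallySmooth A R := .of_isLocalization p.primeCompl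
  have : Algebra.FormallySmooth k R := .comp k A R
  have hgm (j) : algebraMap A R (g j) ∈ maximalIdeal R :=
    (IsLocalization.AtPrime.to_map_mem_maximal_iff R p _).2 (hg j)
  refine Fintype.linearIndependent_iff.2 fun c hc j => ?_
  choose a ha using fun j => residue_surjective (c j)
  rw [← ha, residue_eq_zero_iff]
  refine hmin a ((formallySmooth_residueField_iff_forall_derivation (k := k)).1 ‹_› _
    (Ideal.sum_mem _ fun j _ => Ideal.mul_mem_left _ _ (hgm j)) fun δ => ?_) j
  let η : Ω[A⁄k] →ₗ[A] p.ResidueField := (δ.compAlgebraMap A).liftKaehlerDifferential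
  have hδ (x : A) : δ (algebraMap A R x) =
      ∑ i, algebraMap A p.ResidueField (d i x) * η (ω i) := by
    have := (δ.compAlgebraMap A).liftKaehlerDifferential_comp_D x
    rw [hd, map_sum] at this
    simpa [Algebra.smul_def] using this.symm
  calc δ (∑ j, a j * algebraMap A R (g j))
      = ∑ j, c j * ∑ i, algebraMap A p.ResidueField (d i (g j)) * η (ω i) := by
        rw [derivation_sum_mul_of_map_eq_zero δ a _ fun j => (residue_eq_zero_iff _).2 (hgm j)]
        simp only [hδ, ← ha]; rfl
    _ = ∑ i, (∑ j, c j * algebraMap A p.ResidueField (d i (g j))) * η (ω i) := by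
        simp only [Finset.mul_sum, Finset.sum_mul, mul_assoc]
        exact Finset.sum_comm
    _ = 0 := Finset.sum_eq_zero fun i _ => by
        have : ∑ j, c j * algebraMap A p.ResidueField (d i (g j)) = 0 := by
          simpa using congr_fun hc i
        rw [this, zero_mul]

theorem exists_det_notMem_of_formallySmooth {k A : Type*} [CommRing k] [CommRing A] [Algebra k A]
    [IsNoetherianRing A] [Algebra.FormallySmooth k A] [Module.Finite A Ω[A⁄k]]
    (p : Ideal A) [p.IsPrime] [Algebra.FormallySmooth k p.ResidueField] :
    ∃ (r : ℕ) (d : Fin r → Derivation k A A) (g : Fin r → A),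
      p.map (algebraMap A (Localization.AtPrime p)) =
        Ideal.span (Set.range fun i => algebraMap A (Localization.AtPrime p) (g i)) ∧
      (Matrix.of fun i j => d i (g j)).det ∉ p := by
  have hp : Ideal.span (Set.range fun x : p => algebraMap A (Localization.AtPrime p) x) =
      maximalIdeal (Localization.AtPrime p) := by
    rw [← Localization.AtPrime.map_eq_maximalIdeal, Ideal.map, Set.image_eq_range]
    rfl
  obtain ⟨r, g, hg, hmin⟩ := exists_minimal_generators_maximalIdeal _ hp
  obtain ⟨n, d, ω, hd⟩ := exists_derivation_D_eq_sum_smul k A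
  obtain ⟨f, hf⟩ := exists_det_submatrix_ne_zero
    (linearIndependent_jacobian_col p (fun j => (g j).2) hmin hd)
  refine ⟨r, fun i => d (f i), fun j => g j, Localization.AtPrime.map_eq_maximalIdeal.trans hg.symm,
    fun hdet => hf ?_⟩
  rwa [← Ideal.algebraMap_residueField_eq_zero, RingHom.map_det] at hdet

end Jacobian

section GeometricallyReduced

theorem SeparablyGenerated.formallySmooth {k K : Type*} [Field k] [Field K] [Algebra k K]
    (h : SeparablyGenerated k K) : Algebra.FormallySmooth k K := by
  obtain ⟨T, hT, hsep⟩ := h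
  have : Algebra.IsSeparable (IntermediateField.adjoin k (Set.range ((↑) : T → K))) K := by
    rwa [Subtype.range_coe]
  exact .of_algebraicIndependent_of_isSeparable hT.1

theorem linearIndependent_pow_of_isReduced_tensorProduct {k K L ι : Type*} [Field k] [CommRing K]
    [Nontrivial K] [Algebra k K] [Field L] [Algebra k L] [PerfectField L] [IsReduced (L ⊗[k] K)]
    (p : ℕ) [ExpChar k p] {v : ι → K} (hv : LinearIndependent k v) :
    LinearIndependent k fun i => v i ^ p := by
  have : ExpChar L p := expChar_of_injective_algebraMap (algebraMap k L).injective p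
  have : ExpChar (L ⊗[k] K) p :=
    expChar_of_injective_algebraMap (algebraMap L (L ⊗[k] K)).injective p
  rw [linearIndependent_iff']
  intro s c hc i hi
  choose r hr using fun i => surjective_frobenius L p (algebraMap k L (c i))
  simp only [frobenius_def] at hr
  -- `p`-th roots in `L` of the coefficients turn a relation among the `v i ^ p` into a nilpotent.
  have hpow : (∑ i ∈ s, r i ⊗ₜ[k] v i) ^ p = 0 := by
    rw [sum_pow_char]
    simp only [Algebra.TensorProduct.tmul_pow, hr, Algebra.algebraMap_eq_smul_one,
      TensorProduct.smul_tmul]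
    rw [← TensorProduct.tmul_sum, hc, TensorProduct.tmul_zero]
  have hsum : ∑ i ∈ s, r i • (1 : L) ⊗ₜ[k] v i = 0 := by
    simpa [TensorProduct.smul_tmul'] using eq_zero_of_pow_eq_zero hpow
  have hri : r i = 0 :=
    linearIndependent_iff'.1 (Module.Flat.linearIndependent_one_tmul (S := L) hv) s r hsum i hi
  simpa [hri, (expChar_pos k p).ne'] using (hr i).symm

theorem separablyGenerated_of_isReduced_tensorProduct {k K : Type*} (L : Type*) [Field k]
    [Field K] [Algebra k K] [Algebra.EssFiniteType k K] [Field L] [Algebra k L]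
    [PerfectField L] [IsReduced (L ⊗[k] K)] : SeparablyGenerated k K := by
  obtain _ | ⟨p, hp, _⟩ := CharP.exists' k
  · obtain ⟨s, hs, hsep⟩ := exists_isTranscendenceBasis_and_isSeparable_of_perfectField k K
    exact ⟨s, hs, hsep⟩
  · have : ExpChar k p := .prime hp.1
    obtain ⟨s, hs, hsep⟩ :=
      exists_isTranscendenceBasis_and_isSeparable_of_linearIndepOn_pow_of_essFiniteType (k := k)
        (K := K) p hp.1 fun _ hs => linearIndependent_pow_of_isReduced_tensorProduct (L := L) p hs
    exact ⟨s, hs, hsep⟩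

theorem eq_zero_of_forall_lTensor_eq_zero {k V M ι : Type*} {N : ι → Type*} [CommRing k]
    [AddCommGroup V] [Module k V] [Module.Free k V] [AddCommGroup M] [Module k M]
    [∀ i, AddCommGroup (N i)] [∀ i, Module k (N i)] {f : ∀ i, M →ₗ[k] N i}
    (hf : ∀ x, (∀ i, f i x = 0) → x = 0) {x : V ⊗[k] M} (hx : ∀ i, (f i).lTensor V x = 0) :
    x = 0 := by
  classical
  let b := Module.Free.chooseBasis k V
  have hcoord (i j) (y : V ⊗[k] M) : f i (TensorProduct.equivFinsuppOfBasisLeft b y j) =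
      TensorProduct.equivFinsuppOfBasisLeft b ((f i).lTensor V y) j := by
    induction y with
    | zero => simp
    | tmul v m => simp
    | add y z hy hz => simp [hy, hz]
  apply (TensorProduct.equivFinsuppOfBasisLeft b).injective
  ext j
  rw [map_zero, Finsupp.zero_apply]
  exact hf _ fun i => by simp [hcoord, hx]

theorem isReduced_tensorProduct_of_forall_algHom {k L B ι : Type*} {C : ι → Type*} [CommRing k]
    [CommRing L] [Algebra k L] [Module.Free k L] [CommRing B] [Algebra k B]
    [∀ i, CommRing (C i)] [∀ i, Algebra k (C i)] [∀ i, IsReduced (L ⊗[k] C i)]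
    (f : ∀ i, B →ₐ[k] C i) (hf : ∀ x, (∀ i, f i x = 0) → x = 0) : IsReduced (L ⊗[k] B) :=
  ⟨fun _ hx => eq_zero_of_forall_lTensor_eq_zero (f := fun i => (f i).toLinearMap) hf fun i =>
    (hx.map (Algebra.TensorProduct.map (.id k L) (f i))).eq_zero⟩

theorem isReduced_tensorProduct_of_isLocalization {k L B C : Type*} [CommRing k] [CommRing L]
    [Algebra k L] [CommRing B] [Algebra k B] [CommRing C] [Algebra k C] [Algebra B C]
    [IsScalarTower k B C] (M : Submonoid B) [IsLocalization M C] [IsReduced (L ⊗[k] B)] :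
    IsReduced (L ⊗[k] C) := by
  let φ : L ⊗[k] B →ₐ[L] L ⊗[k] C :=
    Algebra.TensorProduct.map (.id L L) (IsScalarTower.toAlgHom k B C)
  algebraize [φ.toRingHom]
  have : IsScalarTower L (L ⊗[k] B) (L ⊗[k] C) := .of_algebraMap_eq' φ.comp_algebraMap.symm
  let N : Submonoid (L ⊗[k] B) := M.map (Algebra.TensorProduct.includeRight (R := k) (A := L))
  have : IsLocalization N (L ⊗[k] C) :=
    IsLocalization.tensorProduct_tensorProduct_right k L M C (by
      ext b
      simp [RingHom.algebraMap_toAlgebra, φ])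
  exact isReduced_of_injective _
    (IsLocalization.algEquiv N (L ⊗[k] C) (Localization N)).injective

theorem isReduced_tensorProduct_of_isSeparable (k K L : Type*) [Field k] [Field K] [Field L]
    [Algebra k K] [Algebra k L] [Algebra.EssFiniteType k K] [Algebra.IsSeparable k K] :
    IsReduced (L ⊗[k] K) :=
  have := Algebra.FormallyUnramified.of_isSeparable k K
  Algebra.FormallyUnramified.isReduced_of_field L (L ⊗[k] K)

theorem isReduced_tensorProduct_residueField_of_eq_iInf {k A ι : Type*} (L : Type*) [Field k]
    [CommRing A] [Algebra k A] [Algebra.EssFiniteType k A] [Field L] [Algebra k L]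
    {p : Ideal A} [p.IsPrime] {m : ι → Ideal A} [∀ i, (m i).IsPrime]
    [∀ i, Algebra.IsSeparable k (m i).ResidueField] (hp : p = ⨅ i, m i) :
    IsReduced (L ⊗[k] p.ResidueField) := by
  have (i : ι) : Algebra.EssFiniteType k (m i).ResidueField := .comp k A _
  have (i : ι) := isReduced_tensorProduct_of_isSeparable k (m i).ResidueField L
  let f (i : ι) : (A ⧸ p) →ₐ[k] (m i).ResidueField :=
    Ideal.Quotient.liftₐ p (IsScalarTower.toAlgHom k A _) fun a ha => by
      simpa using (hp ▸ iInf_le m i : p ≤ m i) ha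
  have hf (x : A ⧸ p) (hx : ∀ i, f i x = 0) : x = 0 := by
    obtain ⟨a, rfl⟩ := Ideal.Quotient.mk_surjective x
    rw [Ideal.Quotient.eq_zero_iff_mem, hp, Ideal.mem_iInf]
    exact fun i => by simpa [f] using hx i
  have : IsReduced (L ⊗[k] (A ⧸ p)) := isReduced_tensorProduct_of_forall_algHom f hf
  exact isReduced_tensorProduct_of_isLocalization (nonZeroDivisors (A ⧸ p))

end GeometricallyReduced

section SeparablePoints

open PrimeSpectrum

theorem ker_mem_specmSep {k A L : Type*} [Field k] [CommRing A] [Algebra k A] [Field L]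
    [Algebra k L] [Algebra.IsSeparable k L] (f : A →ₐ[k] L) :
    ⟨RingHom.ker f, RingHom.ker_isPrime f⟩ ∈ specmSep k A := by
  have : (RingHom.ker f).IsPrime := RingHom.ker_isPrime f
  have : Algebra.IsIntegral k (A ⧸ RingHom.ker f) :=
    .of_injective (Ideal.kerLiftAlg f) (Ideal.kerLiftAlg_injective f)
  refine ⟨Ideal.Quotient.maximal_of_isField _
    (isField_of_isIntegral_of_isField' (Field.toIsField k)), ?_⟩
  exact .of_algHom k L (Ideal.ResidueField.liftₐ (RingHom.ker f) f le_rfl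
    fun _ hx => IsUnit.mk0 _ hx)

theorem comap_mem_specmSep {k A B : Type*} [Field k] [CommRing A] [Algebra k A] [CommRing B]
    [Algebra k B] (f : A →ₐ[k] B) {q : PrimeSpectrum B}
    (hq : Algebra.IsSeparable k q.asIdeal.ResidueField) :
    comap (f : A →+* B) q ∈ specmSep k A := by
  convert! ker_mem_specmSep ((IsScalarTower.toAlgHom k B q.asIdeal.ResidueField).comp f) using 1
  ext a
  simp

theorem mem_specmSep_iff {k A : Type*} [Field k] [CommRing A] [Algebra k A] {q : PrimeSpectrum A} :
    q ∈ specmSep k A ↔ Algebra.IsSeparable k q.asIdeal.ResidueField :=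
  ⟨And.right, comap_mem_specmSep (AlgHom.id k A)⟩

theorem dense_specmSep_of_injective {k A B : Type*} [Field k] [CommRing A] [Algebra k A]
    [CommRing B] [Algebra k B] {f : A →ₐ[k] B} (hf : Function.Injective f)
    (hB : Dense (specmSep k B)) : Dense (specmSep k A) := by
  have hrange : DenseRange (comap (f : A →+* B)) := by
    rw [denseRange_comap_iff_ker_le_nilRadical,
      (RingHom.injective_iff_ker_eq_bot (f : A →+* B)).1 hf]
    exact bot_le
  refine (hrange.dense_image (continuous_comap _) hB).mono ?_
  rintro _ ⟨q, hq, rfl⟩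
  exact comap_mem_specmSep f hq.2

theorem dense_specmSep_of_etale {k A B : Type*} [Field k] [CommRing A] [Algebra k A] [CommRing B]
    [Algebra k B] [Algebra A B] [IsScalarTower k A B] [Algebra.Etale A B]
    (hA : Dense (specmSep k A)) : Dense (specmSep k B) := by
  refine (hA.preimage (isOpenMap_comap_of_hasGoingDown_of_finitePresentation
    (R := A) (S := B))).mono fun q hq => mem_specmSep_iff.2 ?_
  let P := q.asIdeal.under A
  have : Algebra.IsSeparable k P.ResidueField := hq.2
  let := Localization.AtPrime.algebraOfLiesOver P q.asIdeal
  exact Algebra.IsSeparable.trans k P.ResidueField _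

theorem infinite_of_isSepClosed (L : Type*) [Field L] [IsSepClosed L] : Infinite L := by
  by_contra hL
  have : Finite L := not_infinite_iff_finite.1 hL
  have : IsAlgClosed L := IsSepClosed.isAlgClosed_of_perfectField L
  exact hL inferInstance

theorem dense_specmSep_mvPolynomial (k σ : Type*) [Field k] :
    Dense (specmSep k (MvPolynomial σ k)) := by
  let L := SeparableClosure k
  have : Infinite L := infinite_of_isSepClosed L
  rw [isTopologicalBasis_basic_opens.dense_iff]
  rintro _ ⟨h, rfl⟩ hne
  have hh : h ≠ 0 := by
    rintro rfl
    simp at hne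
  obtain ⟨x, hx⟩ : ∃ x : σ → L, MvPolynomial.aeval x h ≠ 0 := by
    by_contra! hzero
    refine hh (MvPolynomial.map_injective _ (algebraMap k L).injective
      (MvPolynomial.funext fun x => ?_))
    simpa [MvPolynomial.eval_map, MvPolynomial.aeval_def] using hzero x
  exact ⟨_, hx, ker_mem_specmSep (MvPolynomial.aeval x)⟩

theorem isSmoothAt_bot_of_isFractionRing {k B : Type*} (K : Type*) [CommRing k] [CommRing B]
    [IsDomain B] [Algebra k B] [Field K] [Algebra k K] [Algebra B K] [IsScalarTower k B K]
    [IsFractionRing B K] [Algebra.FormallySmooth k K] : Algebra.IsSmoothAt k (⊥ : Ideal B) := by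
  have : IsLocalization (⊥ : Ideal B).primeCompl K := by
    convert! (‹IsFractionRing B K› : IsLocalization (nonZeroDivisors B) K)
    ext
    simp [Ideal.primeCompl]
  exact .of_equiv ((IsLocalization.algEquiv (⊥ : Ideal B).primeCompl K
      (Localization.AtPrime (⊥ : Ideal B))).restrictScalars k)

theorem dense_specmSep_of_formallySmooth {k B : Type*} (K : Type*) [Field k] [CommRing B]
    [IsDomain B] [Algebra k B] [Algebra.FiniteType k B] [Field K] [Algebra k K] [Algebra B K]
    [IsScalarTower k B K] [IsFractionRing B K] [Algebra.FormallySmooth k K] :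
    Dense (specmSep k B) := by
  have : Algebra.FinitePresentation k B := Algebra.FinitePresentation.of_finiteType.1 inferInstance
  have := isSmoothAt_bot_of_isFractionRing (k := k) (B := B) K
  obtain ⟨f, hf, n, _, _, _⟩ :=
    Algebra.IsSmoothAt.exists_isStandardEtale_mvPolynomial (R := k) (p := (⊥ : Ideal B))
  have hinj : Function.Injective (IsScalarTower.toAlgHom k B (Localization.Away f)) :=
    IsLocalization.injective _ (powers_le_nonZeroDivisors_of_noZeroDivisors hf)
  exact dense_specmSep_of_injective hinj
    (dense_specmSep_of_etale (dense_specmSep_mvPolynomial k (Fin n)))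

theorem dense_zeroLocus_iff_zeroLocus_subset_closure {A : Type*} [CommRing A] {s : Set A}
    {S : Set (PrimeSpectrum A)} :
    Dense {x : zeroLocus s | (x : PrimeSpectrum A) ∈ S} ↔
      zeroLocus s ⊆ closure (S ∩ zeroLocus s) := by
  rw [Subtype.dense_iff]
  have himg : ((↑) : zeroLocus s → PrimeSpectrum A) '' {x | (x : PrimeSpectrum A) ∈ S} =
      S ∩ zeroLocus s := by
    ext x; simp [and_comm]
  rw [himg]

theorem dense_zeroLocus_specmSep_of_dense_quotient {k A : Type*} [Field k] [CommRing A]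
    [Algebra k A] {I : Ideal A} (h : Dense (specmSep k (A ⧸ I))) :
    Dense {x : zeroLocus (I : Set A) | (x : PrimeSpectrum A) ∈ specmSep k A} := by
  rw [dense_zeroLocus_iff_zeroLocus_subset_closure]
  have hrange : Set.range (comap (Ideal.Quotient.mk I)) = zeroLocus I := by
    rw [range_comap_of_surjective _ _ Ideal.Quotient.mk_surjective, Ideal.mk_ker]
  rw [← hrange]
  refine ((continuous_comap (Ideal.Quotient.mk I)).range_subset_closure_image_dense h).trans
    (closure_mono ?_)
  rintro _ ⟨q, hq, rfl⟩
  exact ⟨comap_mem_specmSep (Ideal.Quotient.mkₐ k I) hq.2, q, rfl⟩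

theorem dense_zeroLocus_iff_eq_iInf {A : Type*} [CommRing A] {p : Ideal A} (hp : p.IsRadical)
    {S : Set (PrimeSpectrum A)} :
    Dense {x : zeroLocus (p : Set A) | (x : PrimeSpectrum A) ∈ S} ↔
      p = ⨅ m ∈ S ∩ zeroLocus (p : Set A), m.asIdeal := by
  have hle : p ≤ ⨅ m ∈ S ∩ zeroLocus (p : Set A), m.asIdeal := le_iInf₂ fun m hm => hm.2
  rw [dense_zeroLocus_iff_zeroLocus_subset_closure, ← zeroLocus_vanishingIdeal_eq_closure,
    zeroLocus_subset_zeroLocus_iff, vanishingIdeal, hp.radical, hle.ge_iff_eq]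

end SeparablePoints

theorem mainTheorem3_general {k A : Type*} [Field k] [CommRing A] [Algebra k A] [Algebra.Smooth k A]
    (L : Type*) [Field L] [Algebra k L] [PerfectField L] (p : Ideal A) [p.IsPrime] :
    List.TFAE [
      Algebra.FormallySmooth k p.ResidueField,
      ∃ (r : ℕ) (d : Fin r → Derivation k A A) (g : Fin r → A),
        p.map (algebraMap A (Localization.AtPrime p)) =
          Ideal.span (Set.range fun i => algebraMap A (Localization.AtPrime p) (g i)) ∧
        (Matrix.of fun i j => d i (g j)).det ∉ p,
      SeparablyGenerated k p.ResidueField,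
      IsReduced (p.ResidueField ⊗[k] L),
      Dense {x : PrimeSpectrum.zeroLocus (p : Set A) | (x : PrimeSpectrum A) ∈ specmSep k A},
      p = ⨅ m ∈ specmSep k A ∩ PrimeSpectrum.zeroLocus (p : Set A), m.asIdeal] := by
  have : IsNoetherianRing A := Algebra.FiniteType.isNoetherianRing k A
  have : Algebra.EssFiniteType k p.ResidueField := .comp k A _
  tfae_have 1 → 2 := fun _ => exists_det_notMem_of_formallySmooth p
  tfae_have 2 → 1 := fun ⟨_, d, g, hg, hdet⟩ =>
    formallySmooth_residueField_of_det_notMem p d g hg hdet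
  tfae_have 3 → 1 := SeparablyGenerated.formallySmooth
  tfae_have 4 → 3 := fun _ =>
    have : IsReduced (L ⊗[k] p.ResidueField) :=
      isReduced_of_injective _ (Algebra.TensorProduct.comm k L p.ResidueField).injective
    separablyGenerated_of_isReduced_tensorProduct L
  tfae_have 1 → 5 := fun _ =>
    dense_zeroLocus_specmSep_of_dense_quotient (dense_specmSep_of_formallySmooth p.ResidueField)
  tfae_have 5 ↔ 6 := dense_zeroLocus_iff_eq_iInf (Ideal.IsPrime.isRadical ‹_›)
  tfae_have 6 → 4 := fun hp => by
    rw [iInf_subtype'] at hp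
    have (m : ↥(specmSep k A ∩ PrimeSpectrum.zeroLocus (p : Set A))) :
        Algebra.IsSeparable k m.1.asIdeal.ResidueField := m.2.1.2
    have := isReduced_tensorProduct_residueField_of_eq_iInf (k := k) L hp
    exact isReduced_of_injective _ (Algebra.TensorProduct.comm k p.ResidueField L).injective
  tfae_finish

theorem mainTheorem3 {k : Type*} [Field k] (kbar : Type*) [Field kbar] [Algebra k kbar]
    [IsAlgClosure k kbar] (n : ℕ) (p : Ideal (MvPolynomial (Fin n) k)) [p.IsPrime] :
    List.TFAE [
      Algebra.FormallySmooth k p.ResidueField,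
      ∃ (r : ℕ) (d : Fin r → Derivation k (MvPolynomial (Fin n) k) (MvPolynomial (Fin n) k))
        (g : Fin r → MvPolynomial (Fin n) k),
        p.map (algebraMap (MvPolynomial (Fin n) k) (Localization.AtPrime p)) =
          Ideal.span (Set.range fun i =>
            algebraMap (MvPolynomial (Fin n) k) (Localization.AtPrime p) (g i)) ∧
        (Matrix.of fun i j => d i (g j)).det ∉ p,
      SeparablyGenerated k p.ResidueField,
      IsReduced (p.ResidueField ⊗[k] kbar),
      Dense {x : PrimeSpectrum.zeroLocus (p : Set (MvPolynomial (Fin n) k)) |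
        (x : PrimeSpectrum (MvPolynomial (Fin n) k)) ∈ specmSep k (MvPolynomial (Fin n) k)},
      p = ⨅ m ∈ specmSep k (MvPolynomial (Fin n) k) ∩
        PrimeSpectrum.zeroLocus (p : Set (MvPolynomial (Fin n) k)), m.asIdeal] :=
  have : IsAlgClosed kbar := IsAlgClosure.isAlgClosed k
  have : Algebra.Smooth k (MvPolynomial (Fin n) k) := ⟨inferInstance, inferInstance⟩
  mainTheorem3_general kbar p
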